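/- Let $H$ be a complex Hilbert space with inner product $(\cdot,\cdot)$, linear in the first argument. Let $\dot A$ be a densely defined symmetric operator in $H$ with deficiency indices $(1,1)$, that is, $\dim\operatorname{Ker}(\dot A^*-iI)=\dim\operatorname{Ker}(\dot A^*+iI)=1$. Let $\widehat A\ne(\widehat A)^*$ be a maximal dissipative extension of $\dot A$, i.e. $\dot A\subset\widehat A$, $\operatorname{Im}(\widehat A h,h)\ge 0$ for $h\in\operatorname{Dom}(\widehat A)$, and $\widehat A$ has no proper extension with this property; and let $A$ be a self-adjoint extension of $\dot A$. Suppose that $g_\pm\in\operatorname{Ker}(\dot A^*\mp iI)$, $\|g_\pm\|=1$, satisfy $$g_+-g_-\in\operatorname{Dom}(A)\quad\text{and}\quad g_+-\kappa g_-\in\operatorname{Dom}(\widehat A)\quad\text{for some }\kappa\in\mathbb C,\ |\kappa|<1.$$ Then the open upper half-plane $\mathbb C_+$ is contained in the resolvent set of $(\widehat A)^*$, and the Weyl--Titchmarsh function $$\mathcal M(z)=\Bigl(\bigl(z(\widehat A)^*+I\bigr)\bigl((\widehat A)^*-zI\bigr)^{-1}g_+,\,g_+\Bigr),\qquad z\in\mathbb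 C_+,$$ is analytic in $\mathbb C_+$ with values in the disk $$\frac{2|\kappa|}{1-|\kappa|^2}\,\mathbb D+i\,\frac{1+|\kappa|^2}{1-|\kappa|^2},\qquad \mathbb D=\{w\in\mathbb C:|w|<1\}$$ (which is the single point $i$ if $\kappa=0$). Moreover, there is a measurable function $f:\mathbb R\to\mathbb R$ such that $$\mathcal M(z)=\int_{\mathbb R}\left(\frac1{\lambda-z}-\frac{\lambda}{1+\lambda^2}\right)f(\lambda)\,d\lambda,\qquad z\in\mathbb C_+,$$ with absolutely convergent integrals, $$\frac1\pi\cdot\frac{1-|\kappa|}{1+|\kappa|}\le f(\lambda)\le\frac1\pi\cdot\frac{1+|\kappa|}{1-|\kappa|}\quad\text{for a.e. }\lambda\in\mathbb R,\qquad\text{and}\qquad\int_{\mathbb R}\frac{f(\lambda)}{1+\lambda^2}\,d\lambda=1.$$ -/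

import Mathlib

open scoped LinearPMap

namespace WeylTitchmarsh

variable {H : Type*} [NormedAddCommGroup H] [InnerProductSpace ℂ H]

/-- A densely defined symmetric operator: `(T x, y) = (x, T y)` for all `x`, `y` in its domain. -/
def IsSymmetricOp (T : H →ₗ.[ℂ] H) : Prop :=
  Dense (T.domain : Set H) ∧ T.IsFormalAdjoint T

/-- `Im (T x, x) ≥ 0` on the domain of `T`. The inner product `(u, v)`, linear in `u`, is written
`inner ℂ v u` in Mathlib. -/
def IsDissipative (T : H →ₗ.[ℂ] H) : Prop :=
  ∀ x : T.domain, 0 ≤ (inner ℂ (x : H) (T x)).im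

/-- A dissipative operator without proper dissipative extension. -/
def IsMaximalDissipative (T : H →ₗ.[ℂ] H) : Prop :=
  IsDissipative T ∧ ∀ S : H →ₗ.[ℂ] H, IsDissipative S → T ≤ S → S = T

/-- The operator `T - z I` on the domain of `T`. -/
def subScalar (T : H →ₗ.[ℂ] H) (z : ℂ) : T.domain →ₗ[ℂ] H :=
  T.toFun - z • T.domain.subtype

/-- The resolvent set of `T`: `T - z I` is a bijection of the domain of `T` onto `H` with bounded
inverse. -/
def resolventSet (T : H →ₗ.[ℂ] H) : Set ℂ :=
  {z | Function.Bijective (subScalar T z) ∧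
    ∃ C : ℝ, ∀ x : T.domain, ‖(x : H)‖ ≤ C * ‖subScalar T z x‖}

/-- `(T - z I)⁻¹`, as a map from `H` to the domain of `T`. It is meaningful when `z` belongs to the
resolvent set of `T`. -/
noncomputable def resolvent (T : H →ₗ.[ℂ] H) (z : ℂ) : H → T.domain :=
  Function.invFun (subScalar T z)

variable [CompleteSpace H]

/-- The deficiency subspace `Ker (T* - z I)`, as a subspace of `H`. -/
noncomputable def deficiencySpace (T : H →ₗ.[ℂ] H) (z : ℂ) : Submodule ℂ H :=
  (LinearMap.ker (subScalar T† z)).map T†.domain.subtype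

/-- Deficiency indices `(1, 1)`: `dim Ker (T* - i I) = dim Ker (T* + i I) = 1`. -/
def HasDeficiencyIndicesOneOne (T : H →ₗ.[ℂ] H) : Prop :=
  Module.finrank ℂ (deficiencySpace T Complex.I) = 1 ∧
    Module.finrank ℂ (deficiencySpace T (-Complex.I)) = 1

/-- The function `z ↦ ((z T* + I) (T* - z I)⁻¹ g, g)`. -/
noncomputable def weylFunction (T : H →ₗ.[ℂ] H) (g : H) (z : ℂ) : ℂ :=
  inner ℂ g (z • T† (resolvent T† z g) + (resolvent T† z g : H))

end WeylTitchmarsh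

/-! ### Symmetric operators, dissipative extensions and deficiency vectors -/

namespace WeylTitchmarsh

open Filter Topology ComplexConjugate

variable {H : Type*} [NormedAddCommGroup H] [InnerProductSpace ℂ H]

/-! Write `S` for the symmetric operator and `T` for its dissipative extension. Everything is read
off from the Cayley transform `V = (T* + i)(T* - i)⁻¹`. Dissipativity and the deficiency indices
`(1,1)` force a boundary condition on `Dom T` (`inner_sub_eq_mul_inner_add`). By duality it gives
the two facts about `V` that matter (`exists_adjoint_sub_eq`): `(V h, g₊) = κ̄ (h, g₋)` and `‖V h‖²
= ‖h‖² - (1 - |κ|²)|(h, g₋)|²`. So `V` is a contraction of the whole space.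

With `w = (z - i)/(z + i)`, which lies in the unit disk for `z` in the upper half-plane, `M(z) = i
F(w)` where `F(w) = 2((1 - wV)⁻¹g₊, g₊) - 1` (`inner_resolvent_eq`). The two identities give `((1 -
wV)⁻¹g₊, g₊) = 1/(1 - u)` with `u = κ̄ s`, `|s| < 1` (`inner_inverse_eq`). Hence `F(w) = (1 + u)/(1
- u)`, and a Möbius computation locates the disk.

In particular `Re F` is bounded above and below, and `F(0) = 1`. The Schwarz formula represents `F`
by a boundary density `v` obeying the same bounds, a weak limit of `Re F` on circles of radius `r <
1` (`exists_eq_integral_schwarzKernel`). Carried to the line by the Cayley map, arc length becomes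
the Cauchy distribution and the Schwarz kernel becomes the Herglotz kernel, so `f = v/π`. -/

lemma subScalar_apply (T : H →ₗ.[ℂ] H) (z : ℂ) (x : T.domain) :
    subScalar T z x = T x - z • (x : H) := rfl

/-- As `(T x, x)` is real, the cross terms vanish and `‖T x ± i x‖² = ‖T x‖² + ‖x‖²`. -/
lemma IsSymmetricOp.norm_le_norm_subScalar {T : H →ₗ.[ℂ] H} (hT : IsSymmetricOp T)
    (x : T.domain) : ‖(x : H)‖ ≤ ‖subScalar T Complex.I x‖ ∧
      ‖T x - Complex.I • (x : H)‖ = ‖T x + Complex.I • (x : H)‖ := by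
  have h := hT.2 x x
  have hre : (inner ℂ (T x) (Complex.I • (x : H))).re = 0 := by
    have h2 : (inner ℂ (T x) (x : H)).im = 0 := by
      have := congrArg Complex.im h
      rw [← inner_conj_symm (x : H) (T x), Complex.conj_im] at this
      linarith
    rw [inner_smul_right, Complex.mul_re, h2]
    simp
  have h1 := norm_sub_sq (𝕜 := ℂ) (T x) (Complex.I • (x : H))
  have h2 := norm_add_sq (𝕜 := ℂ) (T x) (Complex.I • (x : H))
  simp only [RCLike.re_to_complex, hre, norm_smul, Complex.norm_I, one_mul] at h1 h2
  constructor
  · rw [subScalar_apply]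
    refine le_of_sq_le_sq ?_ (norm_nonneg _)
    nlinarith [sq_nonneg ‖T x‖]
  · refine (sq_eq_sq₀ (norm_nonneg _) (norm_nonneg _)).1 ?_
    linarith

lemma eq_zero_of_forall_mul_add_nonneg {a b : ℝ} (h : ∀ t : ℝ, 0 ≤ t * a + b) : a = 0 := by
  by_contra ha
  have := h (-(b + 1) / a)
  rw [div_mul_cancel₀ _ ha] at this
  linarith

/-- The form `Im (T u, u)` is nonnegative and vanishes on `Dom S`, so its polarization with an
element of `Dom S` vanishes too. In other words `S ⊂ T*` and `T ⊂ S*`. -/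
lemma inner_eq_of_isDissipative_extension {S T : H →ₗ.[ℂ] H} (hS : IsSymmetricOp S)
    (hT : IsDissipative T) (hST : S ≤ T) (x : S.domain) (y : T.domain) :
    inner ℂ (T y) (x : H) = inner ℂ (y : H) (S x) := by
  obtain ⟨x', hx'⟩ : ∃ x' : T.domain, (x' : H) = x := ⟨⟨x, hST.1 x.2⟩, rfl⟩
  have hTx : S x = T x' := hST.2 hx'.symm
  have hxx : (inner ℂ (x : H) (S x)).im = 0 := by
    have := congrArg Complex.im (hS.2 x x)
    rw [← inner_conj_symm (x : H) (S x), Complex.conj_im] at this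
    rw [← inner_conj_symm (x : H) (S x), Complex.conj_im]
    linarith
  -- Dissipativity at `t x + y`: the term in `|t|²` drops out because `(S x, x)` is real. What is
  -- left is affine along the real and the imaginary axis, so both slopes are zero.
  have key : ∀ t : ℂ, 0 ≤ (t * inner ℂ (y : H) (S x) + conj t * inner ℂ (x : H) (T y)).im
      + (inner ℂ (y : H) (T y)).im := by
    intro t
    have h := hT (t • x' + y)
    have e : inner ℂ ((t • x' + y : T.domain) : H) (T (t • x' + y)) =
        (conj t * t) * inner ℂ (x : H) (S x) + (t * inner ℂ (y : H) (S x)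
          + conj t * inner ℂ (x : H) (T y)) + inner ℂ (y : H) (T y) := by
      rw [LinearPMap.map_add, LinearPMap.map_smul, ← hTx]
      simp only [Submodule.coe_add, Submodule.coe_smul, hx', inner_add_left, inner_add_right,
        inner_smul_left, inner_smul_right]
      ring
    rw [e, ← Complex.normSq_eq_conj_mul_self, Complex.add_im, Complex.add_im,
      Complex.im_ofReal_mul, hxx, mul_zero, zero_add] at h
    exact h
  have h1 : (inner ℂ (y : H) (S x)).im + (inner ℂ (x : H) (T y)).im = 0 :=
    eq_zero_of_forall_mul_add_nonneg (b := (inner ℂ (y : H) (T y)).im) fun s => by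
      have := key s
      simp only [Complex.conj_ofReal, Complex.add_im, Complex.im_ofReal_mul] at this
      linarith
  have h2 : (inner ℂ (y : H) (S x)).re - (inner ℂ (x : H) (T y)).re = 0 :=
    eq_zero_of_forall_mul_add_nonneg (b := (inner ℂ (y : H) (T y)).im) fun s => by
      have := key (s * Complex.I)
      simp only [map_mul, Complex.conj_ofReal, Complex.conj_I, Complex.add_im, mul_assoc,
        Complex.im_ofReal_mul, neg_mul, Complex.neg_im, Complex.I_mul_im] at this
      linarith
  rw [← inner_conj_symm]
  apply Complex.ext
  · rw [Complex.conj_re]; linarith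
  · rw [Complex.conj_im]; linarith

lemma exists_smul_of_finrank_eq_one {K : Submodule ℂ H} (hK : Module.finrank ℂ K = 1) {g : H}
    (hg : g ∈ K) (hg0 : ‖g‖ = 1) {x : H} (hx : x ∈ K) : ∃ c : ℂ, x = c • g := by
  have hne : (⟨g, hg⟩ : K) ≠ 0 := by
    intro h
    have : g = 0 := congrArg Subtype.val h
    simp [this] at hg0
  obtain ⟨c, hc⟩ := (finrank_eq_one_iff_of_nonzero' _ hne).1 hK ⟨x, hx⟩
  exact ⟨c, (congrArg Subtype.val hc).symm⟩

variable [CompleteSpace H]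

lemma mem_deficiencySpace_iff {T : H →ₗ.[ℂ] H} (hT : Dense (T.domain : Set H)) {z : ℂ} {g : H} :
    g ∈ deficiencySpace T z ↔ ∀ x : T.domain, inner ℂ g (T x) = conj z * inner ℂ g (x : H) := by
  constructor
  · rintro ⟨v, hv, rfl⟩ x
    have h : T† v = z • (v : H) := by
      have : subScalar T† z v = 0 := hv
      rwa [subScalar_apply, sub_eq_zero] at this
    have := LinearPMap.adjoint_isFormalAdjoint hT v x
    rw [h, inner_smul_left] at this
    exact this.symm
  · intro h
    have h' : ∀ x : T.domain, inner ℂ (z • g) (x : H) = inner ℂ g (T x) := fun x => by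
      rw [inner_smul_left, h]
    have hg := LinearPMap.mem_adjoint_domain_of_exists g ⟨z • g, h'⟩
    refine ⟨⟨g, hg⟩, ?_, rfl⟩
    have : T† ⟨g, hg⟩ = z • g := LinearPMap.adjoint_apply_eq hT _ h'
    simp [subScalar_apply, this]

lemma exists_adjoint_apply {T : H →ₗ.[ℂ] H} (hT : Dense (T.domain : Set H)) {p q : H}
    (h : ∀ z : T.domain, inner ℂ q (z : H) = inner ℂ p (T z)) :
    ∃ v : T†.domain, (v : H) = p ∧ T† v = q :=
  ⟨⟨p, LinearPMap.mem_adjoint_domain_of_exists p ⟨q, h⟩⟩, rfl, LinearPMap.adjoint_apply_eq hT _ h⟩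

/-- The range of the closure of `T - i` is the orthogonal complement of `Ker (T* + i)`. -/
lemma IsSymmetricOp.exists_tendsto {T : H →ₗ.[ℂ] H} (hT : IsSymmetricOp T)
    {g u : H} (hdef : Module.finrank ℂ (deficiencySpace T (-Complex.I)) = 1)
    (hg : g ∈ deficiencySpace T (-Complex.I)) (hg1 : ‖g‖ = 1) (hu : inner ℂ g u = 0) :
    ∃ (s : ℕ → T.domain) (x y : H), Tendsto (fun n => (s n : H)) atTop (𝓝 x) ∧
      Tendsto (fun n => T (s n)) atTop (𝓝 y) ∧ y - Complex.I • x = u := by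
  set R : Submodule ℂ H := LinearMap.range (subScalar T Complex.I) with hR
  -- The orthogonal complement of the range of `T - i` is `Ker (T* + i)`, which `g` spans.
  have hmem : u ∈ R.topologicalClosure := by
    rw [← Submodule.orthogonal_orthogonal_eq_closure, Submodule.mem_orthogonal]
    intro v hv
    have hv' : v ∈ deficiencySpace T (-Complex.I) := by
      rw [mem_deficiencySpace_iff hT.1]
      intro x
      have := (Submodule.mem_orthogonal' _ _).1 hv (subScalar T Complex.I x) ⟨x, rfl⟩
      rw [subScalar_apply, inner_sub_right, inner_smul_right, sub_eq_zero] at this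
      simp [this]
    obtain ⟨c, rfl⟩ := exists_smul_of_finrank_eq_one hdef hg hg1 hv'
    rw [inner_smul_left, hu, mul_zero]
  obtain ⟨r, hr, hru⟩ := mem_closure_iff_seq_limit.1 hmem
  choose s hs using hr
  -- `T - i` is bounded below by `1`, so convergence of the images makes the preimages Cauchy.
  have hc : CauchySeq (fun n => (s n : H)) := by
    refine Metric.cauchySeq_iff.2 fun ε hε => ?_
    obtain ⟨N, hN⟩ := Metric.cauchySeq_iff.1 hru.cauchySeq ε hε
    refine ⟨N, fun m hm n hn => lt_of_le_of_lt ?_ (hN m hm n hn)⟩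
    rw [dist_eq_norm, dist_eq_norm, ← hs, ← hs, ← map_sub]
    exact (hT.norm_le_norm_subScalar (s m - s n)).1
  obtain ⟨x, hx⟩ := cauchySeq_tendsto_of_complete hc
  refine ⟨s, x, u + Complex.I • x, hx, ?_, by abel⟩
  refine (hru.add (hx.const_smul Complex.I)).congr fun n => ?_
  rw [← hs, subScalar_apply]
  abel

end WeylTitchmarsh

/-! ### Boundary condition on the extension and solution of the adjoint equation -/

namespace WeylTitchmarsh

open Filter Topology ComplexConjugate

variable {H : Type*} [NormedAddCommGroup H] [InnerProductSpace ℂ H] [CompleteSpace H]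

variable {S T : H →ₗ.[ℂ] H} {gp gm : H} {κ : ℂ}

/-- `T ⊂ S*`, and `S*` multiplies `g₊` by `i` and `g₋` by `-i`. -/
lemma dissipative_apply_sub_smul (hS : IsSymmetricOp S) (hT : IsDissipative T) (hST : S ≤ T)
    (hgp : gp ∈ deficiencySpace S Complex.I) (hgm : gm ∈ deficiencySpace S (-Complex.I))
    (e : T.domain) (he : (e : H) = gp - κ • gm) :
    T e = Complex.I • (gp + κ • gm) := by
  refine hS.1.eq_of_inner_left ℂ fun x hx => ?_
  have h := inner_eq_of_isDissipative_extension hS hT hST ⟨x, hx⟩ e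
  rw [mem_deficiencySpace_iff hS.1] at hgp hgm
  rw [he, inner_sub_left, inner_smul_left, hgp, hgm] at h
  simp only [Complex.conj_I, map_neg] at h
  rw [h]
  simp only [inner_smul_left, inner_add_left, Complex.conj_I]
  ring

/-- The boundary condition satisfied by the elements of the domain of a dissipative extension. -/
lemma inner_sub_eq_mul_inner_add (hS : IsSymmetricOp S) (hdef : HasDeficiencyIndicesOneOne S)
    (hT : IsDissipative T) (hST : S ≤ T)
    (hgp : gp ∈ deficiencySpace S Complex.I) (hgp1 : ‖gp‖ = 1)
    (hgm : gm ∈ deficiencySpace S (-Complex.I)) (hgm1 : ‖gm‖ = 1)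
    (hdom : gp - κ • gm ∈ T.domain) (h : T.domain) :
    inner ℂ gm (T h - Complex.I • (h : H)) = κ * inner ℂ gp (T h + Complex.I • (h : H)) := by
  obtain ⟨e, he⟩ : ∃ e : T.domain, (e : H) = gp - κ • gm := ⟨⟨_, hdom⟩, rfl⟩
  have hTe := dissipative_apply_sub_smul hS hT hST hgp hgm e he
  have hpp : inner ℂ gp gp = 1 := by simp [inner_self_eq_norm_sq_to_K, hgp1]
  have hmm : inner ℂ gm gm = 1 := by simp [inner_self_eq_norm_sq_to_K, hgm1]
  have hII := Complex.I_mul_I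
  -- Since `(T + i)e = 2i g₊`, this `c` makes `(T + i)(h - c e)` orthogonal to `g₊`. The number `q`
  -- below is then the defect in the boundary condition, and dissipativity will force it to vanish.
  set c : ℂ := -(Complex.I / 2) * inner ℂ gp (T h + Complex.I • (h : H)) with hc
  set h' : T.domain := h - c • e with hh'
  have hplus : inner ℂ gp (T h' + Complex.I • (h' : H)) = 0 := by
    rw [hh', LinearPMap.map_sub, LinearPMap.map_smul, hTe]
    simp only [Submodule.coe_sub, Submodule.coe_smul, he, inner_add_right, inner_sub_right,
      inner_smul_right, hpp] at hc ⊢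
    linear_combination (inner ℂ gp (T h) + Complex.I * inner ℂ gp (h : H)) * hII
      - 2 * Complex.I * hc
  set q : ℂ := inner ℂ gm (T h' - Complex.I • (h' : H)) with hq
  have hqeq : q = inner ℂ gm (T h - Complex.I • (h : H))
      - κ * inner ℂ gp (T h + Complex.I • (h : H)) := by
    rw [hq, hh', LinearPMap.map_sub, LinearPMap.map_smul, hTe]
    simp only [Submodule.coe_sub, Submodule.coe_smul, he, inner_add_right, inner_sub_right,
      inner_smul_right, hmm] at hc ⊢
    linear_combination κ * (inner ℂ gp (T h) + Complex.I * inner ℂ gp (h : H)) * hII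
      - 2 * κ * Complex.I * hc
  -- Subtracting a limit of graph points of `S` from `(h', T h')` leaves a pair `(X, Y)` in the
  -- graph of `S*` with `Y - i X = q g₋`.
  obtain ⟨s, x, y, hx, hy, hxy⟩ := hS.exists_tendsto hdef.2 hgm hgm1
    (u := T h' - Complex.I • (h' : H) - q • gm)
    (by rw [inner_sub_right, inner_smul_right, hmm, ← hq]; ring)
  set X : H := (h' : H) - x with hX
  set Y : H := T h' - y with hY
  have hYX : Y - Complex.I • X = q • gm := by
    rw [hX, hY, smul_sub, show q • gm = T h' - Complex.I • (h' : H) - (y - Complex.I • x) by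
      rw [hxy]; abel]
    abel
  have hlimX : Tendsto (fun n => (h' : H) - (s n : H)) atTop (𝓝 X) := hx.const_sub _
  have hlimY : Tendsto (fun n => T h' - S (s n)) atTop (𝓝 Y) := hy.const_sub _
  have hadj : ∀ z : S.domain, inner ℂ Y (z : H) = inner ℂ X (S z) := fun z => by
    refine tendsto_nhds_unique (hlimY.inner tendsto_const_nhds)
      ((hlimX.inner tendsto_const_nhds).congr fun n => ?_)
    rw [inner_sub_left, inner_sub_left, inner_eq_of_isDissipative_extension hS hT hST, hS.2]
  -- `(i/2) q g₋` is a particular solution of `(S* - i)X = q g₋`, because `(S* - i)g₋ = -2i g₋`.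
  have hker : X - (Complex.I / 2 * q) • gm ∈ deficiencySpace S Complex.I := by
    rw [mem_deficiencySpace_iff hS.1]
    intro z
    have hgm' := (mem_deficiencySpace_iff hS.1).1 hgm z
    have hY' : Y = Complex.I • X + q • gm := by rw [← hYX]; abel
    have := hadj z
    rw [hY'] at this
    simp only [inner_add_left, inner_sub_left, inner_smul_left, hgm', Complex.conj_I, map_neg,
      map_mul, map_div₀, map_ofNat] at this ⊢
    linear_combination -this + conj q * inner ℂ gm (z : H) * hII
  obtain ⟨c', hc'⟩ := exists_smul_of_finrank_eq_one hdef.1 hgp hgp1 hker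
  have hXe : X = c' • gp + (Complex.I / 2 * q) • gm := by rw [← hc']; abel
  have hYXp : Y + Complex.I • X = (2 * Complex.I * c') • gp := by
    have : Y = Complex.I • X + q • gm := by rw [← hYX]; abel
    rw [this, hXe]
    simp only [smul_add, smul_smul]
    linear_combination (norm := module) (q * hII) • gm
  -- Both `(T + i)h'` and the range of `S + i` are orthogonal to `g₊`; this kills the `g₊` component
  -- of `X`.
  have hzero : inner ℂ gp (Y + Complex.I • X) = 0 := by
    refine tendsto_nhds_unique
      (tendsto_const_nhds.inner (hlimY.add (hlimX.const_smul Complex.I)))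
      (tendsto_const_nhds.congr fun n => ?_)
    have hgp' := (mem_deficiencySpace_iff hS.1).1 hgp (s n)
    simp only [inner_add_right, inner_sub_right, inner_smul_right, hgp', Complex.conj_I]
      at hplus ⊢
    linear_combination -hplus
  have hc0 : c' = 0 := by
    rw [hYXp, inner_smul_right, hpp] at hzero
    simpa using hzero
  have hXq : X = (Complex.I / 2 * q) • gm := by rw [hXe, hc0, zero_smul, zero_add]
  have hYq : Y = (q / 2) • gm := by
    have : Y = Complex.I • X + q • gm := by rw [← hYX]; abel
    rw [this, hXq]
    simp only [smul_smul]
    linear_combination (norm := module) (q / 2 * hII) • gm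
  -- Dissipativity at `h' - s n` passes to the limit. But `(Y, X) = -i|q|²/4`, hence `q = 0`.
  have him : 0 ≤ (inner ℂ X Y).im := by
    refine ge_of_tendsto' ((Complex.continuous_im.tendsto _).comp (hlimX.inner hlimY)) fun n => ?_
    obtain ⟨s', hs'⟩ : ∃ s' : T.domain, (s' : H) = s n := ⟨⟨s n, hST.1 (s n).2⟩, rfl⟩
    have := hT (h' - s')
    rw [LinearPMap.map_sub, Submodule.coe_sub, hs', ← hST.2 hs'.symm] at this
    exact this
  have hq0 : q = 0 := by
    rw [hXq, hYq, inner_smul_left, inner_smul_right, hmm] at him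
    have : conj (Complex.I / 2 * q) * (q / 2 * 1) = -((Complex.normSq q / 4 : ℝ) : ℂ) * Complex.I := by
      push_cast
      rw [Complex.normSq_eq_conj_mul_self]
      simp only [map_mul, map_div₀, Complex.conj_I, map_ofNat]
      ring
    rw [this] at him
    simp at him
    exact Complex.normSq_eq_zero.1 (le_antisymm (by linarith) (Complex.normSq_nonneg q))
  rw [hq0] at hqeq
  linear_combination -hqeq

/-- Solution of `(T* - i) v = h`, together with the value `(T* + i) v`. -/
lemma exists_adjoint_sub_eq (hS : IsSymmetricOp S) (hdef : HasDeficiencyIndicesOneOne S)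
    (hT : IsDissipative T) (hST : S ≤ T)
    (hgp : gp ∈ deficiencySpace S Complex.I) (hgp1 : ‖gp‖ = 1)
    (hgm : gm ∈ deficiencySpace S (-Complex.I)) (hgm1 : ‖gm‖ = 1)
    (hdom : gp - κ • gm ∈ T.domain) (h : H) :
    ∃ v : T†.domain, T† v - Complex.I • (v : H) = h ∧
      inner ℂ gp (T† v + Complex.I • (v : H)) = conj κ * inner ℂ gm h ∧
      ‖T† v + Complex.I • (v : H)‖ ^ 2 = ‖h‖ ^ 2 - (1 - ‖κ‖ ^ 2) * ‖inner ℂ gm h‖ ^ 2 := by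
  have hpp : inner ℂ gp gp = 1 := by simp [inner_self_eq_norm_sq_to_K, hgp1]
  have hmm : inner ℂ gm gm = 1 := by simp [inner_self_eq_norm_sq_to_K, hgm1]
  have hII := Complex.I_mul_I
  have hTd : Dense (T.domain : Set H) := hS.1.mono hST.1
  set α : ℂ := inner ℂ gm h with hα
  have hu : inner ℂ gm (h - α • gm) = 0 := by
    rw [inner_sub_right, inner_smul_right, hmm, ← hα]; ring
  obtain ⟨s, x, y, hx, hy, hxy⟩ := hS.exists_tendsto hdef.2 hgm hgm1 hu
  have hadj : ∀ z : T.domain, inner ℂ y (z : H) = inner ℂ x (T z) := fun z => by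
    refine tendsto_nhds_unique (hy.inner tendsto_const_nhds)
      ((hx.inner tendsto_const_nhds).congr fun n => ?_)
    rw [← inner_conj_symm, inner_eq_of_isDissipative_extension hS hT hST (s n) z,
      inner_conj_symm]
  -- The boundary condition, reread: `g₋ - κ̄ g₊` lies in `Dom T*` and is sent to `-i(g₋ + κ̄ g₊)`.
  have hbc : ∀ z : T.domain, inner ℂ (-Complex.I • (gm + conj κ • gp)) (z : H) =
      inner ℂ (gm - conj κ • gp) (T z) := fun z => by
    have := inner_sub_eq_mul_inner_add hS hdef hT hST hgp hgp1 hgm hgm1 hdom z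
    simp only [inner_add_left, inner_sub_left, inner_smul_left, inner_add_right, inner_sub_right,
      inner_smul_right, map_neg, Complex.conj_I, Complex.conj_conj] at this ⊢
    linear_combination -this
  -- `T* - i` sends `(i/2)(g₋ - κ̄ g₊)` to `g₋`, and `T* + i` sends it to `κ̄ g₊`. The pair `(x, y)`
  -- accounts for the part of `h` orthogonal to `g₋`.
  obtain ⟨v, hv, hTv⟩ := exists_adjoint_apply hTd
    (p := x + (α * (Complex.I / 2)) • (gm - conj κ • gp))
    (q := y + (α * (Complex.I / 2)) • (-Complex.I • (gm + conj κ • gp))) fun z => by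
      rw [inner_add_left, inner_add_left, inner_smul_left _ _ (_ * _), inner_smul_left _ _ (_ * _),
        hadj, hbc]
  have hplus : T† v + Complex.I • (v : H) = (y + Complex.I • x) + (α * conj κ) • gp := by
    rw [hv, hTv]
    simp only [smul_add, smul_sub, smul_smul]
    linear_combination (norm := module) (-(α * conj κ) * hII) • gp
  have horth : inner ℂ gp (y + Complex.I • x) = 0 := by
    refine tendsto_nhds_unique
      (tendsto_const_nhds.inner (hy.add (hx.const_smul Complex.I)))
      (tendsto_const_nhds.congr fun n => ?_)
    have hgp' := (mem_deficiencySpace_iff hS.1).1 hgp (s n)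
    simp only [inner_add_right, inner_smul_right, hgp', Complex.conj_I]
    ring
  -- The Cayley transform of a symmetric operator is isometric, also in the limit.
  have hnorm : ‖y + Complex.I • x‖ = ‖h - α • gm‖ := by
    rw [← hxy]
    refine tendsto_nhds_unique (hy.add (hx.const_smul Complex.I)).norm
      ((hy.sub (hx.const_smul Complex.I)).norm.congr fun n => ?_)
    exact (hS.norm_le_norm_subScalar (s n)).2
  refine ⟨v, ?_, ?_, ?_⟩
  · have : h = y - Complex.I • x + α • gm := by rw [hxy]; abel
    rw [this, hv, hTv]
    simp only [smul_add, smul_sub, smul_smul]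
    linear_combination (norm := module) (-α * hII) • gm
  · rw [hplus, inner_add_right, horth, inner_smul_right, hpp]
    ring
  · rw [hplus, norm_add_sq (𝕜 := ℂ), hnorm, inner_smul_right,
      ← inner_conj_symm, horth]
    have h2 := norm_add_sq (𝕜 := ℂ) (h - α • gm) (α • gm)
    rw [inner_smul_right, ← inner_conj_symm, hu, sub_add_cancel] at h2
    simp only [map_zero, mul_zero, add_zero, norm_smul, norm_mul, hgm1, hgp1, mul_one,
      RCLike.norm_conj] at h2 ⊢
    linear_combination -h2

end WeylTitchmarsh

/-! ### The Cayley transform, the resolvent and the disk of values -/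

namespace WeylTitchmarsh

open Filter Topology ComplexConjugate

variable {H : Type*} [NormedAddCommGroup H] [InnerProductSpace ℂ H]

/-- `V` is the Cayley transform `(B + i)(B - i)⁻¹` of `B`, a contraction of the whole space. -/
structure IsCayleyTransform (V : H →L[ℂ] H) (B : H →ₗ.[ℂ] H) : Prop where
  exists_eq : ∀ h : H, ∃ v : B.domain, B v - Complex.I • (v : H) = h
  apply_eq : ∀ v : B.domain, V (B v - Complex.I • (v : H)) = B v + Complex.I • (v : H)
  norm_le : ‖V‖ ≤ 1

lemma norm_sub_div_add_lt_one {z : ℂ} (hz : 0 < z.im) :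
    ‖(z - Complex.I) / (z + Complex.I)‖ < 1 ∧ z + Complex.I ≠ 0 := by
  have h0 : z + Complex.I ≠ 0 := fun h => by
    have := congrArg Complex.im h
    simp at this
    linarith
  refine ⟨?_, h0⟩
  rw [norm_div, div_lt_one (norm_pos_iff.2 h0)]
  refine lt_of_pow_lt_pow_left₀ 2 (norm_nonneg _) ?_
  rw [Complex.sq_norm, Complex.sq_norm, Complex.normSq_apply, Complex.normSq_apply]
  simp
  nlinarith

namespace IsCayleyTransform

variable {V : H →L[ℂ] H} {B : H →ₗ.[ℂ] H}

/-- Put `f = (B - i)v`. Then `B v = (f + V f)/2` and `v = (V f - f)/(2i)`, so every combination of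
`B v` and `v` is one of `f` and `V f`. This gives the factorization `B - z = c(1 - wV)(B - i)`. -/
lemma subScalar_eq (hV : IsCayleyTransform V B) {z : ℂ} (hz : z + Complex.I ≠ 0) (v : B.domain) :
    subScalar B z v = ((z + Complex.I) / (2 * Complex.I)) •
      ((B v - Complex.I • (v : H)) - ((z - Complex.I) / (z + Complex.I)) •
        V (B v - Complex.I • (v : H))) := by
  rw [subScalar_apply, hV.apply_eq]
  match_scalars <;> field_simp <;> ring

lemma smul_add_eq (hV : IsCayleyTransform V B) {z : ℂ} (hz : z + Complex.I ≠ 0) (v : B.domain) :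
    z • B v + (v : H) = Complex.I • ((z + Complex.I) / (2 * Complex.I)) •
      ((B v - Complex.I • (v : H)) + ((z - Complex.I) / (z + Complex.I)) •
        V (B v - Complex.I • (v : H))) := by
  rw [hV.apply_eq]
  have hII := Complex.I_sq
  match_scalars
  · field_simp
    ring
  · field_simp
    linear_combination 2 * hII

lemma norm_le_norm (hV : IsCayleyTransform V B) (v : B.domain) :
    ‖(v : H)‖ ≤ ‖B v - Complex.I • (v : H)‖ := by
  have h : (2 * Complex.I) • (v : H) =
      V (B v - Complex.I • (v : H)) - (B v - Complex.I • (v : H)) := by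
    rw [hV.apply_eq]; module
  have h1 : ‖(2 * Complex.I) • (v : H)‖ = 2 * ‖(v : H)‖ := by simp [norm_smul]
  have h2 := norm_sub_le (V (B v - Complex.I • (v : H))) (B v - Complex.I • (v : H))
  have h3 := V.le_of_opNorm_le hV.norm_le (B v - Complex.I • (v : H))
  rw [← h, h1] at h2
  linarith

lemma le_norm_sub_smul (hV : ‖V‖ ≤ 1) (w : ℂ) (h : H) :
    (1 - ‖w‖) * ‖h‖ ≤ ‖h - w • V h‖ := by
  have h2 := norm_sub_norm_le h (w • V h)
  have h3 := V.le_of_opNorm_le hV h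
  rw [norm_smul] at h2
  nlinarith [mul_le_mul_of_nonneg_left h3 (norm_nonneg w)]

variable [CompleteSpace H]

lemma isUnit_one_sub_smul (hV : ‖V‖ ≤ 1) {w : ℂ} (hw : ‖w‖ < 1) : IsUnit (1 - w • V) := by
  refine isUnit_one_sub_of_norm_lt_one ?_
  rw [norm_smul]
  nlinarith [norm_nonneg w, norm_nonneg V]

lemma sub_smul_inverse_apply (hV : ‖V‖ ≤ 1) {w : ℂ} (hw : ‖w‖ < 1) (h : H) :
    Ring.inverse (1 - w • V) h - w • V (Ring.inverse (1 - w • V) h) = h := by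
  have := Ring.mul_inverse_cancel _ (isUnit_one_sub_smul hV hw)
  simpa using congrArg (fun L : H →L[ℂ] H => L h) this

/-- In `B - z = c(1 - wV)(B - i)` the middle factor is invertible by the Neumann series, as `‖wV‖ <
1`. The lower bounds of the factors multiply to the resolvent estimate. -/
lemma mem_resolventSet (hV : IsCayleyTransform V B) {z : ℂ} (hz : 0 < z.im) :
    z ∈ resolventSet B := by
  obtain ⟨hw, hz0⟩ := norm_sub_div_add_lt_one hz
  set w := (z - Complex.I) / (z + Complex.I) with hwdef
  set c := (z + Complex.I) / (2 * Complex.I) with hc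
  have hc0 : c ≠ 0 := div_ne_zero hz0 (by simp)
  have hcpos : 0 < ‖c‖ := norm_pos_iff.2 hc0
  have hbound : ∀ v : B.domain, ‖(v : H)‖ ≤ (‖c‖ * (1 - ‖w‖))⁻¹ * ‖subScalar B z v‖ := by
    intro v
    rw [hV.subScalar_eq hz0, ← hwdef, ← hc, norm_smul, ← div_eq_inv_mul, le_div_iff₀
      (mul_pos hcpos (by linarith))]
    have h1 := le_norm_sub_smul hV.norm_le w (B v - Complex.I • (v : H))
    have h2 := hV.norm_le_norm v
    calc ‖(v : H)‖ * (‖c‖ * (1 - ‖w‖)) = ‖c‖ * ((1 - ‖w‖) * ‖(v : H)‖) := by ring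
      _ ≤ ‖c‖ * ((1 - ‖w‖) * ‖B v - Complex.I • (v : H)‖) := by
        have : 0 ≤ 1 - ‖w‖ := by linarith
        gcongr
      _ ≤ _ := by gcongr
  refine ⟨⟨?_, fun y => ?_⟩, _, hbound⟩
  · rw [← LinearMap.ker_eq_bot, LinearMap.ker_eq_bot']
    intro v hv
    have := hbound v
    rw [hv, norm_zero, mul_zero] at this
    exact Subtype.ext (norm_le_zero_iff.1 this)
  · obtain ⟨v, hv⟩ := hV.exists_eq (Ring.inverse (1 - w • V) (c⁻¹ • y))
    refine ⟨v, ?_⟩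
    rw [hV.subScalar_eq hz0, ← hwdef, ← hc, hv, sub_smul_inverse_apply hV.norm_le hw,
      smul_inv_smul₀ hc0]

/-- With `x = (1 - wV)⁻¹g`, one has `z B v + v = i(x + wV x) = i(2x - g)`. -/
lemma inner_resolvent_eq (hV : IsCayleyTransform V B) {z : ℂ} (hz : 0 < z.im) {g : H}
    (hg : ‖g‖ = 1) :
    inner ℂ g (z • B (resolvent B z g) + (resolvent B z g : H)) = Complex.I *
      (2 * inner ℂ g (Ring.inverse (1 - ((z - Complex.I) / (z + Complex.I)) • V) g) - 1) := by
  obtain ⟨hw, hz0⟩ := norm_sub_div_add_lt_one hz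
  set w := (z - Complex.I) / (z + Complex.I) with hwdef
  set c := (z + Complex.I) / (2 * Complex.I) with hc
  have hc0 : c ≠ 0 := div_ne_zero hz0 (by simp)
  set v := resolvent B z g with hv
  have hres : subScalar B z v = g :=
    Function.rightInverse_invFun (hV.mem_resolventSet hz).1.2 g
  set x := Ring.inverse (1 - w • V) g with hx
  have hx1 : x - w • V x = g := sub_smul_inverse_apply hV.norm_le hw g
  -- Both sides solve `y - wV y = g`, and `1 - wV` is injective by its lower bound.
  have hvx : c • (B v - Complex.I • (v : H)) = x := by
    have h0 : c • (B v - Complex.I • (v : H)) - x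
        - w • V (c • (B v - Complex.I • (v : H)) - x) = 0 := by
      rw [hV.subScalar_eq hz0, ← hwdef, ← hc] at hres
      rw [map_sub, map_smul]
      linear_combination (norm := module) hres - hx1
    have := le_norm_sub_smul hV.norm_le w (c • (B v - Complex.I • (v : H)) - x)
    rw [h0, norm_zero] at this
    have h1 : ‖c • (B v - Complex.I • (v : H)) - x‖ ≤ 0 := by
      by_contra hcon
      nlinarith
    exact sub_eq_zero.1 (norm_le_zero_iff.1 h1)
  have hgg : inner ℂ g g = 1 := by simp [inner_self_eq_norm_sq_to_K, hg]
  have : z • B v + (v : H) = Complex.I • ((2 : ℂ) • x - g) := by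
    rw [hV.smul_add_eq hz0, ← hwdef, ← hc, smul_add, smul_comm c w, ← map_smul, hvx, ← hx1]
    module
  rw [this, inner_smul_right, inner_sub_right, inner_smul_right, hgg]

end IsCayleyTransform

/-- The image of the disk `|u| < |κ|` under `u ↦ (1 + u) / (1 - u)`. -/
lemma mobius_mem_disk {κ s : ℂ} (hκ : ‖κ‖ < 1) (hs : ‖s‖ < 1) :
    ∃ w : ℂ, ‖w‖ < 1 ∧ 2 * (1 / (1 - conj κ * s)) - 1 =
      (((1 + ‖κ‖ ^ 2) / (1 - ‖κ‖ ^ 2) : ℝ) : ℂ) + ((2 * ‖κ‖ / (1 - ‖κ‖ ^ 2) : ℝ) : ℂ) * w := by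
  rcases eq_or_ne κ 0 with rfl | hκ0
  · refine ⟨0, by simp, ?_⟩
    simp
    norm_num
  set ρ := ‖κ‖ with hρ
  have hρ0 : 0 < ρ := norm_pos_iff.2 hκ0
  set u := conj κ * s with hu
  have hun : ‖u‖ < ρ := by
    rw [hu, norm_mul, RCLike.norm_conj]
    nlinarith
  have hu1 : 1 - u ≠ 0 := fun h => by
    have : u = 1 := by linear_combination -h
    rw [this, norm_one] at hun
    linarith
  have hρ2 : 0 < 1 - ρ ^ 2 := by nlinarith
  have hρ2' : (1 - (ρ : ℂ) ^ 2) ≠ 0 := by exact_mod_cast hρ2.ne'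
  have hρ' : (ρ : ℂ) ≠ 0 := by exact_mod_cast hρ0.ne'
  -- Obtained by solving for `w`. It lies in the disk because `ρ²|1 - u|² - |u - ρ²|² = (1 - ρ²)(ρ²
  -- - |u|²)`.
  refine ⟨(u - (ρ : ℂ) ^ 2) / (ρ * (1 - u)), ?_, ?_⟩
  · rw [norm_div, div_lt_one (norm_pos_iff.2 (mul_ne_zero hρ' hu1))]
    refine lt_of_pow_lt_pow_left₀ 2 (norm_nonneg _) ?_
    have h2 : ‖u‖ ^ 2 < ρ ^ 2 := by nlinarith [norm_nonneg u]
    rw [Complex.sq_norm, Complex.normSq_apply] at h2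
    rw [Complex.sq_norm, Complex.sq_norm, Complex.normSq_mul, Complex.normSq_ofReal,
      Complex.normSq_apply, Complex.normSq_apply, ← Complex.ofReal_pow]
    simp only [Complex.sub_re, Complex.sub_im, Complex.ofReal_re, Complex.ofReal_im,
      Complex.one_re, Complex.one_im]
    nlinarith [mul_pos hρ2 (sub_pos.2 h2)]
  · push_cast
    field_simp
    ring

/-- For `x = (1 - wV)⁻¹g₊`, `a = (x, g₊)`, `α = (x, g₋)`, the first identity reads `a = 1 + κ̄ wα`.
Combined with the norm identity it yields `|a|² - |wα|² = (1 - |w|²)‖x‖² > 0`, so `s = wα/a` works.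
-/
lemma inner_inverse_eq [CompleteSpace H] {V : H →L[ℂ] H} {gp gm : H} {κ w : ℂ}
    (hV : ‖V‖ ≤ 1) (hgp : ‖gp‖ = 1)
    (hV_inner : ∀ h, inner ℂ gp (V h) = conj κ * inner ℂ gm h)
    (hV_norm : ∀ h, ‖V h‖ ^ 2 = ‖h‖ ^ 2 - (1 - ‖κ‖ ^ 2) * ‖inner ℂ gm h‖ ^ 2)
    (hw : ‖w‖ < 1) :
    ∃ s : ℂ, ‖s‖ < 1 ∧
      inner ℂ gp (Ring.inverse (1 - w • V) gp) = 1 / (1 - conj κ * s) := by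
  set x := Ring.inverse (1 - w • V) gp with hx
  have hx1 : x - w • V x = gp := IsCayleyTransform.sub_smul_inverse_apply hV hw gp
  have hgg : inner ℂ gp gp = 1 := by simp [inner_self_eq_norm_sq_to_K, hgp]
  set a := inner ℂ gp x with ha
  set α := inner ℂ gm x with hα
  have h1 : a = 1 + conj κ * (w * α) := by
    have := congrArg (inner ℂ gp) hx1
    rw [inner_sub_right, inner_smul_right, hV_inner, hgg] at this
    linear_combination this
  have hwx : w • V x = x - gp := by rw [← hx1]; abel
  have hn : ‖w‖ ^ 2 * (‖x‖ ^ 2 - (1 - ‖κ‖ ^ 2) * ‖α‖ ^ 2) = ‖x‖ ^ 2 - 2 * a.re + 1 := by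
    rw [← hV_norm, ← mul_pow, ← norm_smul, hwx, norm_sub_sq (𝕜 := ℂ), hgp, ← inner_conj_symm, ← ha]
    simp
  have hx0 : 0 < ‖x‖ := by
    rw [norm_pos_iff]
    intro h0
    rw [h0] at hx1
    simp at hx1
    simp [← hx1] at hgp
  have hlt : ‖w * α‖ < ‖a‖ := by
    refine lt_of_pow_lt_pow_left₀ 2 (norm_nonneg _) ?_
    have e : ‖κ‖ ^ 2 * ‖w * α‖ ^ 2 = ‖a‖ ^ 2 - 2 * a.re + 1 := by
      have : conj κ * (w * α) = a - 1 := by rw [h1]; ring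
      rw [← mul_pow, ← RCLike.norm_conj κ, ← norm_mul, this, Complex.sq_norm, Complex.sq_norm,
        Complex.normSq_apply, Complex.normSq_apply]
      simp
      ring
    rw [norm_mul, mul_pow] at e ⊢
    have : 0 < (1 - ‖w‖ ^ 2) * ‖x‖ ^ 2 := by
      have : ‖w‖ ^ 2 < 1 := by nlinarith [norm_nonneg w]
      have : 0 < 1 - ‖w‖ ^ 2 := by linarith
      positivity
    nlinarith
  have ha0 : a ≠ 0 := norm_pos_iff.1 (lt_of_le_of_lt (norm_nonneg _) hlt)
  have hmul : a * (1 - conj κ * (w * α / a)) = 1 := by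
    field_simp
    linear_combination h1
  refine ⟨w * α / a, ?_, ?_⟩
  · rw [norm_div, div_lt_one (norm_pos_iff.2 ha0)]
    exact hlt
  · exact eq_one_div_of_mul_eq_one_left hmul

variable [CompleteSpace H] {S T : H →ₗ.[ℂ] H} {gp gm : H} {κ : ℂ}

lemma exists_isCayleyTransform (hS : IsSymmetricOp S) (hdef : HasDeficiencyIndicesOneOne S)
    (hT : IsDissipative T) (hST : S ≤ T)
    (hgp : gp ∈ deficiencySpace S Complex.I) (hgp1 : ‖gp‖ = 1)
    (hgm : gm ∈ deficiencySpace S (-Complex.I)) (hgm1 : ‖gm‖ = 1)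
    (hκ : ‖κ‖ < 1) (hdom : gp - κ • gm ∈ T.domain) :
    ∃ V : H →L[ℂ] H, IsCayleyTransform V T† ∧
      (∀ h, inner ℂ gp (V h) = conj κ * inner ℂ gm h) ∧
      ∀ h, ‖V h‖ ^ 2 = ‖h‖ ^ 2 - (1 - ‖κ‖ ^ 2) * ‖inner ℂ gm h‖ ^ 2 := by
  have hTd : Dense (T.domain : Set H) := hS.1.mono hST.1
  have hpp : inner ℂ gp gp = 1 := by simp [inner_self_eq_norm_sq_to_K, hgp1]
  have hex := exists_adjoint_sub_eq hS hdef hT hST hgp hgp1 hgm hgm1 hdom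
  -- A kernel vector of `T* - i` lies in `Ker (S* - i)`, so it is `c g₊`. Pairing it with `g₊ - κ
  -- g₋` in `Dom T`, the overlaps `(g₋, g₊)` cancel and leave `2i c̄ = 0`.
  have hinj : Function.Injective (subScalar T† Complex.I) := by
    rw [← LinearMap.ker_eq_bot, LinearMap.ker_eq_bot']
    intro v hv
    rw [subScalar_apply, sub_eq_zero] at hv
    have hform := LinearPMap.adjoint_isFormalAdjoint hTd v
    have hmem : (v : H) ∈ deficiencySpace S Complex.I := by
      rw [mem_deficiencySpace_iff hS.1]
      intro x
      obtain ⟨x', hx'⟩ : ∃ x' : T.domain, (x' : H) = x := ⟨⟨x, hST.1 x.2⟩, rfl⟩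
      rw [hST.2 hx'.symm, ← hform x', hv, inner_smul_left, hx']
    obtain ⟨c, hc⟩ := exists_smul_of_finrank_eq_one hdef.1 hgp hgp1 hmem
    obtain ⟨e, he⟩ : ∃ e : T.domain, (e : H) = gp - κ • gm := ⟨⟨_, hdom⟩, rfl⟩
    have h1 := hform e
    rw [hv, dissipative_apply_sub_smul hS hT hST hgp hgm e he, he, hc] at h1
    simp only [inner_smul_left, inner_smul_right, inner_sub_right, inner_add_right, hpp,
      Complex.conj_I] at h1
    have h2 : conj c * (2 * Complex.I) = 0 := by linear_combination -h1
    have h3 : c = 0 := by simpa using h2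
    exact Subtype.ext (by rw [hc, h3, zero_smul]; rfl)
  have hbij : Function.Bijective (subScalar T† Complex.I) :=
    ⟨hinj, fun h => (hex h).imp fun v hv => hv.1⟩
  let E := LinearEquiv.ofBijective (subScalar T† Complex.I) hbij
  let W : H →ₗ[ℂ] H := (T†.toFun + Complex.I • T†.domain.subtype) ∘ₗ E.symm.toLinearMap
  have hW : ∀ v : T†.domain, W (T† v - Complex.I • (v : H)) = T† v + Complex.I • (v : H) := by
    intro v
    have : E.symm (T† v - Complex.I • (v : H)) = v := E.symm_apply_apply v
    simp only [W, LinearMap.comp_apply, LinearEquiv.coe_coe, this]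
    rfl
  have hWprop : ∀ h, inner ℂ gp (W h) = conj κ * inner ℂ gm h ∧
      ‖W h‖ ^ 2 = ‖h‖ ^ 2 - (1 - ‖κ‖ ^ 2) * ‖inner ℂ gm h‖ ^ 2 := by
    intro h
    obtain ⟨v, rfl, h1, h2⟩ := hex h
    rw [hW]
    exact ⟨h1, h2⟩
  have hWle : ∀ h, ‖W h‖ ≤ 1 * ‖h‖ := fun h => by
    rw [one_mul]
    refine le_of_sq_le_sq ?_ (norm_nonneg _)
    rw [(hWprop h).2]
    have : 0 ≤ (1 - ‖κ‖ ^ 2) * ‖inner ℂ gm h‖ ^ 2 := by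
      have : 0 ≤ 1 - ‖κ‖ ^ 2 := by nlinarith [norm_nonneg κ]
      positivity
    linarith
  refine ⟨W.mkContinuous 1 hWle, ⟨fun h => (hex h).imp fun v hv => hv.1, hW,
    W.mkContinuous_norm_le zero_le_one hWle⟩, fun h => (hWprop h).1, fun h => (hWprop h).2⟩

end WeylTitchmarsh

/-! ### Weak compactness of bounded densities -/

namespace WeylTitchmarsh

open Filter Topology MeasureTheory

/-- Banach–Alaoglu along an ultrafilter: no subsequence, hence no separability, is needed. -/
lemma exists_tendsto_inner_of_norm_le {E : Type*} [NormedAddCommGroup E] [InnerProductSpace ℝ E]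
    [CompleteSpace E] (u : ℕ → E) {C : ℝ} (hu : ∀ n, ‖u n‖ ≤ C) :
    ∃ (v : E) (l : Filter ℕ), l.NeBot ∧ l ≤ atTop ∧
      ∀ φ : E, Tendsto (fun n => inner ℝ (u n) φ) l (𝓝 (inner ℝ v φ)) := by
  let l : Ultrafilter ℕ := Ultrafilter.of atTop
  let d : ℕ → WeakDual ℝ E := fun n =>
    StrongDual.toWeakDual (InnerProductSpace.toDual ℝ E (u n))
  have hmem : ∀ n, d n ∈ WeakDual.toStrongDual ⁻¹' Metric.closedBall (0 : StrongDual ℝ E) C := by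
    intro n
    simpa [d] using hu n
  obtain ⟨y, -, hy⟩ := (WeakDual.isCompact_closedBall (𝕜 := ℝ) (0 : StrongDual ℝ E) C)
    |>.ultrafilter_le_nhds (l.map d) (by
      simp only [Ultrafilter.coe_map, le_principal_iff, mem_map]
      exact Filter.univ_mem' hmem)
  refine ⟨(InnerProductSpace.toDual ℝ E).symm (WeakDual.toStrongDual y), l, inferInstance,
    Ultrafilter.of_le _, fun φ => ?_⟩
  have h := ((WeakDual.eval_continuous φ).tendsto y).comp (show Tendsto d l (𝓝 y) from hy)
  rw [InnerProductSpace.toDual_symm_apply]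
  exact h

/-- Weak compactness of sets of uniformly bounded functions on a finite measure space. -/
lemma exists_tendsto_integral_mul {α : Type*} [MeasurableSpace α] (μ : Measure α)
    [IsFiniteMeasure μ] {lo hi : ℝ} (u : ℕ → α → ℝ) (hu : ∀ n, Measurable (u n))
    (hb : ∀ n x, u n x ∈ Set.Icc lo hi) :
    ∃ (v : α → ℝ) (l : Filter ℕ), l.NeBot ∧ l ≤ atTop ∧ Measurable v ∧
      (∀ᵐ x ∂μ, v x ∈ Set.Icc lo hi) ∧
      ∀ φ : α → ℝ, MemLp φ 2 μ →
        Tendsto (fun n => ∫ x, u n x * φ x ∂μ) l (𝓝 (∫ x, v x * φ x ∂μ)) := by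
  have hbd : ∀ n x, ‖u n x‖ ≤ max |lo| |hi| := fun n x => by
    rw [Real.norm_eq_abs]
    exact abs_le_max_abs_abs (hb n x).1 (hb n x).2
  have hmem : ∀ n, MemLp (u n) 2 μ := fun n =>
    MemLp.of_bound (hu n).aestronglyMeasurable _ (Eventually.of_forall (hbd n))
  have hinner : ∀ {f g : α → ℝ} (hf : MemLp f 2 μ) (hg : MemLp g 2 μ),
      inner ℝ (hf.toLp f) (hg.toLp g) = ∫ x, f x * g x ∂μ := by
    intro f g hf hg
    rw [L2.inner_def]
    refine integral_congr_ae ?_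
    filter_upwards [hf.coeFn_toLp, hg.coeFn_toLp] with x h1 h2
    rw [h1, h2]
    simp [mul_comm]
  obtain ⟨v, l, hl, hle, hv⟩ := exists_tendsto_inner_of_norm_le (fun n => (hmem n).toLp (u n))
    (C := (μ.real Set.univ) ^ ((2 : ENNReal).toReal)⁻¹ * max |lo| |hi|) (fun n => by
      refine Lp.norm_le_of_ae_bound (le_max_of_le_left (abs_nonneg _)) ?_
      filter_upwards [(hmem n).coeFn_toLp] with x hx
      rw [hx]
      exact hbd n x)
  have hvm : AEStronglyMeasurable v μ := (Lp.memLp v).1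
  set v' : α → ℝ := hvm.mk v with hv'
  have hvv : v =ᵐ[μ] v' := hvm.ae_eq_mk
  have hv'm : MemLp v' 2 μ := (memLp_congr_ae hvv).1 (Lp.memLp v)
  have hvLp : hv'm.toLp v' = v := by
    rw [← Lp.toLp_coeFn v (Lp.memLp v)]
    exact MemLp.toLp_congr _ _ hvv.symm
  have hlim : ∀ φ : α → ℝ, MemLp φ 2 μ →
        Tendsto (fun n => ∫ x, u n x * φ x ∂μ) l (𝓝 (∫ x, v' x * φ x ∂μ)) := by
    intro φ hφ
    have := hv (hφ.toLp φ)
    rw [← hvLp, hinner hv'm hφ] at this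
    exact this.congr fun n => hinner (hmem n) hφ
  have hvi : Integrable v' μ := hv'm.integrable one_le_two
  -- Testing against indicators transfers the pointwise bounds to the weak limit.
  have hset : ∀ s, MeasurableSet s →
      Tendsto (fun n => ∫ x in s, u n x ∂μ) l (𝓝 (∫ x in s, v' x ∂μ)) := by
    intro s hs
    have h1 : MemLp (s.indicator (fun _ => (1 : ℝ))) 2 μ :=
      (memLp_const (1 : ℝ)).indicator hs
    have h2 : ∀ f : α → ℝ, ∫ x, f x * s.indicator (fun _ => (1 : ℝ)) x ∂μ = ∫ x in s, f x ∂μ := by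
      intro f
      rw [← integral_indicator hs]
      congr 1
      ext x
      by_cases hx : x ∈ s <;> simp [hx]
    simpa only [h2] using hlim _ h1
  refine ⟨v', l, hl, hle, hvm.stronglyMeasurable_mk.measurable, ?_, hlim⟩
  have hlo : (fun _ => lo) ≤ᵐ[μ] v' :=
    ae_le_of_forall_setIntegral_le (integrable_const lo) hvi fun s hs _ =>
      ge_of_tendsto' (hset s hs) fun n =>
        setIntegral_mono (integrable_const lo).integrableOn
          ((hmem n).integrable one_le_two).integrableOn fun x => (hb n x).1
  have hhi : v' ≤ᵐ[μ] (fun _ => hi) :=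
    ae_le_of_forall_setIntegral_le hvi (integrable_const hi) fun s hs _ =>
      le_of_tendsto' (hset s hs) fun n =>
        setIntegral_mono ((hmem n).integrable one_le_two).integrableOn
          (integrable_const hi).integrableOn fun x => (hb n x).2
  filter_upwards [hlo, hhi] with x h1 h2 using ⟨h1, h2⟩

end WeylTitchmarsh

/-! ### The Cauchy distribution and the Schwarz formula on the unit disk -/

namespace WeylTitchmarsh

open Filter Topology MeasureTheory ProbabilityTheory ComplexConjugate

lemma cauchyPDF_toReal (t : ℝ) : (cauchyPDF 0 1 t).toReal = Real.pi⁻¹ * (1 + t ^ 2)⁻¹ := by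
  rw [cauchyPDF_def, ENNReal.toReal_ofReal (cauchyPDF_pos 0 one_ne_zero t).le, cauchyPDFReal_def]
  simp [add_comm]

lemma integral_cauchyMeasure {E : Type*} [NormedAddCommGroup E] [NormedSpace ℝ E] (f : ℝ → E) :
    ∫ t, f t ∂(cauchyMeasure 0 1) = ∫ t, (Real.pi⁻¹ * (1 + t ^ 2)⁻¹) • f t := by
  rw [cauchyMeasure_of_scale_ne_zero 0 one_ne_zero,
    integral_withDensity_eq_integral_toReal_smul (measurable_cauchyPDF _ _)
      (ae_of_all _ fun _ => ENNReal.ofReal_lt_top)]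
  simp only [cauchyPDF_toReal]

lemma integrable_cauchyMeasure_iff {E : Type*} [NormedAddCommGroup E] [NormedSpace ℝ E]
    {f : ℝ → E} : Integrable f (cauchyMeasure 0 1) ↔
      Integrable (fun t => (Real.pi⁻¹ * (1 + t ^ 2)⁻¹) • f t) := by
  rw [cauchyMeasure_of_scale_ne_zero 0 one_ne_zero,
    integrable_withDensity_iff_integrable_smul' (measurable_cauchyPDF _ _)
      (ae_of_all _ fun _ => ENNReal.ofReal_lt_top)]
  simp only [cauchyPDF_toReal]

lemma ae_of_ae_cauchyMeasure {p : ℝ → Prop} (h : ∀ᵐ t ∂(cauchyMeasure 0 1), p t) :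
    ∀ᵐ t : ℝ, p t := by
  rw [cauchyMeasure_of_scale_ne_zero 0 one_ne_zero,
    ae_withDensity_iff (measurable_cauchyPDF _ _)] at h
  filter_upwards [h] with t ht
  refine ht ?_
  rw [cauchyPDF_def]
  exact (ENNReal.ofReal_pos.2 (cauchyPDF_pos 0 one_ne_zero t)).ne'

/-- The Cayley map from the real line to the unit circle. -/
noncomputable def cayley (t : ℝ) : ℂ := (t - Complex.I) / (t + Complex.I)

lemma ofReal_add_I_ne_zero (t : ℝ) : (t : ℂ) + Complex.I ≠ 0 := fun h => by
  simpa using congrArg Complex.im h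

lemma ofReal_sub_I_ne_zero (t : ℝ) : (t : ℂ) - Complex.I ≠ 0 := fun h => by
  simpa using congrArg Complex.im h

lemma cayley_ne_zero (t : ℝ) : cayley t ≠ 0 :=
  div_ne_zero (ofReal_sub_I_ne_zero t) (ofReal_add_I_ne_zero t)

lemma conj_cayley (t : ℝ) : conj (cayley t) = (cayley t)⁻¹ := by
  simp [cayley, ← sub_eq_add_neg]

lemma norm_cayley (t : ℝ) : ‖cayley t‖ = 1 := by
  have h : (Complex.normSq (cayley t) : ℂ) = 1 := by
    rw [Complex.normSq_eq_conj_mul_self, conj_cayley, inv_mul_cancel₀ (cayley_ne_zero t)]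
  rw [Complex.norm_def, show Complex.normSq (cayley t) = 1 by exact_mod_cast h, Real.sqrt_one]

lemma continuous_cayley : Continuous cayley := by
  unfold cayley
  exact Continuous.div (by fun_prop) (by fun_prop) ofReal_add_I_ne_zero

lemma continuous_cayley_zpow (n : ℤ) : Continuous fun t => cayley t ^ n :=
  continuous_cayley.zpow₀ n fun t => Or.inl (cayley_ne_zero t)

lemma norm_cayley_zpow (t : ℝ) (n : ℤ) : ‖cayley t ^ n‖ = 1 := by
  rw [norm_zpow, norm_cayley, one_zpow]

lemma one_add_ofReal_sq_ne_zero (t : ℝ) : (1 + (t : ℂ) ^ 2) ≠ 0 := by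
  have : (1 + t ^ 2 : ℝ) ≠ 0 := by positivity
  exact_mod_cast this

lemma hasDerivAt_cayley (t : ℝ) :
    HasDerivAt cayley (cayley t * (2 * Complex.I / (1 + (t : ℂ) ^ 2))) t := by
  have h1 := ofReal_add_I_ne_zero t
  have h : HasDerivAt (fun z : ℂ => (z - Complex.I) / (z + Complex.I)) _ (t : ℂ) :=
    ((hasDerivAt_id (t : ℂ)).sub_const Complex.I).div
      ((hasDerivAt_id (t : ℂ)).add_const Complex.I) h1
  convert! h.comp_ofReal using 1
  have h2 := one_add_ofReal_sq_ne_zero t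
  have h3 : (1 + (t : ℂ) ^ 2) = (t - Complex.I) * (t + Complex.I) := by
    linear_combination Complex.I_sq
  have h4 := ofReal_sub_I_ne_zero t
  rw [h3, cayley]
  simp only [id]
  field_simp
  ring

lemma tendsto_cayley {l : Filter ℝ} (hl : Tendsto (fun t : ℝ => |t|) l atTop) :
    Tendsto cayley l (𝓝 1) := by
  have h1 : Tendsto (fun t : ℝ => (t : ℂ) + Complex.I) l (Bornology.cobounded ℂ) := by
    rw [← tendsto_norm_atTop_iff_cobounded]
    refine tendsto_atTop_mono (fun t => ?_) hl
    simpa using Complex.abs_re_le_norm ((t : ℂ) + Complex.I)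
  have h2 := ((tendsto_inv₀_cobounded.comp h1).const_mul (2 * Complex.I)).const_sub 1
  rw [mul_zero, sub_zero] at h2
  refine h2.congr fun t => ?_
  have := ofReal_add_I_ne_zero t
  simp only [Function.comp_apply, cayley]
  field_simp
  ring

/-- Orthogonality of characters on the circle. For `n ≠ 0` the integrand is, up to the factor `2πi
n`, the derivative of `cayley t ^ n`, which tends to `1` at both ends of the line. -/
lemma integral_cayley_zpow (n : ℤ) :
    ∫ t, cayley t ^ n ∂(cauchyMeasure 0 1) = if n = 0 then 1 else 0 := by
  split_ifs with hn
  · simp [hn]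
  have hint : Integrable (fun t => cayley t ^ n) (cauchyMeasure 0 1) :=
    Integrable.of_bound (continuous_cayley_zpow n).aestronglyMeasurable 1
      (Eventually.of_forall fun t => (norm_cayley_zpow t n).le)
  have hderiv : ∀ t : ℝ, HasDerivAt (fun t => cayley t ^ n)
      ((2 * Real.pi * Complex.I * n) * ((Real.pi⁻¹ * (1 + t ^ 2)⁻¹ : ℝ) • cayley t ^ n)) t := by
    intro t
    have h := (hasDerivAt_zpow n (cayley t) (Or.inl (cayley_ne_zero t))).comp t
      (hasDerivAt_cayley t)
    convert! h using 1
    have h0 := cayley_ne_zero t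
    have h2 := one_add_ofReal_sq_ne_zero t
    have hpi : (Real.pi : ℂ) ≠ 0 := by exact_mod_cast Real.pi_ne_zero
    rw [zpow_sub_one₀ h0, Complex.real_smul]
    push_cast
    field_simp
  have h := integral_of_hasDerivAt_of_tendsto hderiv
    ((integrable_cauchyMeasure_iff.1 hint).const_mul _)
    ((tendsto_cayley tendsto_abs_atBot_atTop).zpow₀ n (Or.inl one_ne_zero))
    ((tendsto_cayley tendsto_abs_atTop_atTop).zpow₀ n (Or.inl one_ne_zero))
  rw [sub_self, integral_const_mul, ← integral_cauchyMeasure] at h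
  have hc : (2 * Real.pi * Complex.I * n : ℂ) ≠ 0 := by
    simp [Real.pi_ne_zero, hn]
  exact (mul_eq_zero.1 h).resolve_left hc

lemma cayley_sub_ne_zero {w : ℂ} (hw : ‖w‖ < 1) (t : ℝ) : cayley t - w ≠ 0 := fun h => by
  have : cayley t = w := sub_eq_zero.1 h
  rw [← this, norm_cayley] at hw
  exact lt_irrefl _ hw

/-- The Schwarz kernel of the unit disk, on the boundary parametrized by the real line. -/
noncomputable def schwarzKernel (w : ℂ) (t : ℝ) : ℂ := (cayley t + w) / (cayley t - w)

lemma continuous_schwarzKernel {w : ℂ} (hw : ‖w‖ < 1) : Continuous (schwarzKernel w) :=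
  (continuous_cayley.add continuous_const).div (continuous_cayley.sub continuous_const)
    (cayley_sub_ne_zero hw)

lemma norm_schwarzKernel_le {w : ℂ} (hw : ‖w‖ < 1) (t : ℝ) :
    ‖schwarzKernel w t‖ ≤ 2 / (1 - ‖w‖) := by
  rw [schwarzKernel, norm_div]
  have h1 := norm_add_le (cayley t) w
  have h2 := norm_sub_norm_le (cayley t) w
  rw [norm_cayley] at h1 h2
  exact div_le_div₀ zero_le_two (by linarith) (by linarith) h2

lemma integral_schwarzKernel_mul_zpow {w : ℂ} (hw : ‖w‖ < 1) (m : ℤ) :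
    ∫ t, schwarzKernel w t * cayley t ^ m ∂(cauchyMeasure 0 1) =
      (if 0 ≤ m then 2 * w ^ m.toNat else 0) - if m = 0 then 1 else 0 := by
  -- Adding `1` to the kernel leaves a pure geometric series, `2 ∑ wⁿ ζ⁻ⁿ` with `ζ = cayley t`;
  -- after multiplication by `ζᵐ` only the term `n = m` has nonzero integral.
  have hsum : HasSum (fun n : ℕ => ∫ t, 2 * w ^ n * cayley t ^ (m - n) ∂(cauchyMeasure 0 1))
      (∫ t, (schwarzKernel w t * cayley t ^ m + cayley t ^ m) ∂(cauchyMeasure 0 1)) := by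
    refine hasSum_integral_of_dominated_convergence (fun n _ => 2 * ‖w‖ ^ n)
      (fun n => (continuous_const.mul (continuous_cayley_zpow _)).aestronglyMeasurable)
      (fun n => Eventually.of_forall fun t => ?_) (Eventually.of_forall fun _ => ?_)
      (integrable_const _) (Eventually.of_forall fun t => ?_)
    · rw [norm_mul, norm_cayley_zpow]
      simp
    · exact (summable_geometric_of_lt_one (norm_nonneg _) hw).mul_left 2
    · have h0 := cayley_ne_zero t
      have h1 := cayley_sub_ne_zero hw t
      have hg := (hasSum_geometric_of_norm_lt_one (ξ := w * (cayley t)⁻¹)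
        (by simpa [norm_cayley] using hw)).mul_left (2 * cayley t ^ m)
      convert! hg using 1
      · ext n
        rw [mul_pow, zpow_sub₀ h0, zpow_natCast, inv_pow]
        field_simp
      · have h2 : 1 - w * (cayley t)⁻¹ = (cayley t - w) / cayley t := by field_simp
        rw [h2, schwarzKernel]
        field_simp
        ring
  have hint : ∀ {f : ℝ → ℂ} (C : ℝ), Continuous f → (∀ t, ‖f t‖ ≤ C) →
      Integrable f (cauchyMeasure 0 1) := fun C hf hC =>
    Integrable.of_bound hf.aestronglyMeasurable C (Eventually.of_forall hC)
  rw [integral_add (hint (f := fun t => schwarzKernel w t * cayley t ^ m) (2 / (1 - ‖w‖))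
      ((continuous_schwarzKernel hw).mul (continuous_cayley_zpow m)) fun t => by
        rw [norm_mul, norm_cayley_zpow, mul_one]; exact norm_schwarzKernel_le hw t)
    (hint 1 (continuous_cayley_zpow m) fun t => (norm_cayley_zpow t m).le),
    integral_cayley_zpow] at hsum
  have hterm : ∀ n : ℕ, ∫ t, 2 * w ^ n * cayley t ^ (m - n) ∂(cauchyMeasure 0 1) =
      if m = n then 2 * w ^ n else 0 := fun n => by
    rw [integral_const_mul, integral_cayley_zpow]
    simp only [sub_eq_zero]
    split_ifs <;> simp
  simp only [hterm] at hsum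
  have hval : HasSum (fun n : ℕ => if m = n then 2 * w ^ n else 0)
      (if 0 ≤ m then 2 * w ^ m.toNat else 0) := by
    split_ifs with hm
    · obtain ⟨k, rfl⟩ := Int.eq_ofNat_of_zero_le hm
      have := hasSum_ite_eq k (2 * w ^ k)
      convert! this using 1
      ext n
      by_cases h : n = k
      · simp [h]
      · have h' : ¬ k = n := fun e => h e.symm
        simp [h, h']
    · convert! hasSum_zero using 1
      ext n
      rw [if_neg]
      omega
  rw [eq_sub_iff_add_eq]
  exact hsum.unique hval

/-- The Schwarz formula on circles of radius `r < 1`. -/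
lemma integral_schwarzKernel_mul_re {F : ℂ → ℂ} (hF : DifferentiableOn ℂ F (Metric.ball 0 1))
    (hF0 : (F 0).im = 0) {r : ℝ} (hr0 : 0 ≤ r) (hr : r < 1) {w : ℂ} (hw : ‖w‖ < 1) :
    ∫ t, schwarzKernel w t * ((F (r * cayley t)).re : ℂ) ∂(cauchyMeasure 0 1) = F (r * w) := by
  set c : ℕ → ℂ := fun n => (n.factorial : ℂ)⁻¹ * iteratedDeriv n F 0 with hc
  have hsum : ∀ z : ℂ, ‖z‖ < 1 → HasSum (fun n => c n * z ^ n) (F z) := fun z hz => by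
    have := Complex.hasSum_taylorSeries_on_ball hF (z := z) (by simpa using hz)
    convert! this using 1
    ext n
    simp only [hc, sub_zero, smul_eq_mul]
    ring
  have hc0 : conj (c 0) = c 0 := by
    have : c 0 = F 0 := by simp [hc]
    rw [this, Complex.conj_eq_iff_im, hF0]
  have hsr : Summable fun n => ‖c n‖ * r ^ n := by
    have := (hsum r (by simpa [abs_of_nonneg hr0] using hr)).summable.norm
    simpa [abs_of_nonneg hr0] using this
  have hK := norm_schwarzKernel_le hw
  -- Here `Re F(rζ)` is half the sum of the Taylor series and its conjugate, with `ζ̄ = ζ⁻¹`. For `n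
  -- ≥ 1` the kernel doubles `ζⁿ` and kills `ζ⁻ⁿ`; for `n = 0` the two halves add up to `c 0`
  -- because it is real.
  have hmain : HasSum (fun n : ℕ => ∫ t, (c n * r ^ n / 2 *
        (schwarzKernel w t * cayley t ^ (n : ℤ)) + conj (c n) * r ^ n / 2 *
        (schwarzKernel w t * cayley t ^ (-(n : ℤ)))) ∂(cauchyMeasure 0 1))
      (∫ t, schwarzKernel w t * ((F (r * cayley t)).re : ℂ) ∂(cauchyMeasure 0 1)) := by
    refine hasSum_integral_of_dominated_convergence
      (fun n _ => ‖c n‖ * r ^ n * (2 / (1 - ‖w‖)))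
      (fun n => (Continuous.add (continuous_const.mul
        ((continuous_schwarzKernel hw).mul (continuous_cayley_zpow _))) (continuous_const.mul
        ((continuous_schwarzKernel hw).mul (continuous_cayley_zpow _)))).aestronglyMeasurable)
      (fun n => Eventually.of_forall fun t => ?_) (Eventually.of_forall fun _ => ?_)
      (integrable_const _) (Eventually.of_forall fun t => ?_)
    · refine (norm_add_le _ _).trans ?_
      simp only [norm_mul, norm_div, norm_pow, RCLike.norm_conj, norm_cayley_zpow,
        Complex.norm_real, Real.norm_eq_abs, abs_of_nonneg hr0, Complex.norm_ofNat, mul_one]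
      have : 0 ≤ ‖c n‖ * r ^ n := by positivity
      nlinarith [mul_le_mul_of_nonneg_left (hK t) this]
    · exact hsr.mul_right _
    · have h1 : ‖(r : ℂ) * cayley t‖ < 1 := by
        simpa [norm_cayley, abs_of_nonneg hr0] using hr
      have h2 := hsum _ h1
      convert! (h2.add h2.star).mul_left (schwarzKernel w t / 2) using 1
      · ext n
        simp only [Complex.star_def, map_mul, map_pow, Complex.conj_ofReal, conj_cayley, mul_pow,
          zpow_neg, zpow_natCast, inv_pow]
        ring
      · rw [Complex.re_eq_add_conj, Complex.star_def]
        ring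
  have hint : ∀ m : ℤ, Integrable (fun t => schwarzKernel w t * cayley t ^ m)
      (cauchyMeasure 0 1) := fun m =>
    Integrable.of_bound ((continuous_schwarzKernel hw).mul
      (continuous_cayley_zpow m)).aestronglyMeasurable (2 / (1 - ‖w‖))
      (Eventually.of_forall fun t => by
        rw [norm_mul, norm_cayley_zpow, mul_one]; exact hK t)
  refine hmain.unique ?_
  have hrw : ‖(r : ℂ) * w‖ < 1 := by
    rw [norm_mul, Complex.norm_real, Real.norm_eq_abs, abs_of_nonneg hr0]
    nlinarith [norm_nonneg w]
  convert! hsum _ hrw using 1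
  ext n
  rw [integral_add ((hint _).const_mul _) ((hint _).const_mul _), integral_const_mul,
    integral_const_mul, integral_schwarzKernel_mul_zpow hw, integral_schwarzKernel_mul_zpow hw]
  rcases Nat.eq_zero_or_pos n with rfl | hn
  · simp [hc0]
    ring
  · rw [if_pos (by positivity), if_neg (by omega), if_neg (by omega), if_neg (by omega), mul_pow]
    simp
    ring

/-- Schwarz integral formula for a holomorphic function in the unit disk with bounded real part. -/
theorem exists_eq_integral_schwarzKernel {F : ℂ → ℂ}
    (hF : DifferentiableOn ℂ F (Metric.ball 0 1)) (hF0 : (F 0).im = 0) {lo hi : ℝ}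
    (hb : ∀ w : ℂ, ‖w‖ < 1 → (F w).re ∈ Set.Icc lo hi) :
    ∃ v : ℝ → ℝ, Measurable v ∧ (∀ᵐ t ∂(cauchyMeasure 0 1), v t ∈ Set.Icc lo hi) ∧
      ∀ w : ℂ, ‖w‖ < 1 →
        Integrable (fun t => schwarzKernel w t * (v t : ℂ)) (cauchyMeasure 0 1) ∧
        F w = ∫ t, schwarzKernel w t * (v t : ℂ) ∂(cauchyMeasure 0 1) := by
  set r : ℕ → ℝ := fun n => 1 - 1 / ((n : ℝ) + 1) with hr
  have hr0 : ∀ n, 0 ≤ r n := fun n => by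
    have : 1 / ((n : ℝ) + 1) ≤ 1 := by
      rw [div_le_one (by positivity)]
      have : (0 : ℝ) ≤ n := n.cast_nonneg
      linarith
    simp only [hr]; linarith
  have hr1 : ∀ n, r n < 1 := fun n => by
    have : 0 < 1 / ((n : ℝ) + 1) := by positivity
    simp only [hr]; linarith
  have hrlim : Tendsto r atTop (𝓝 1) := by
    simpa [hr] using (tendsto_one_div_add_atTop_nhds_zero_nat (𝕜 := ℝ)).const_sub 1
  have hin : ∀ n t, ‖(r n : ℂ) * cayley t‖ < 1 := fun n t => by
    simpa [norm_cayley, abs_of_nonneg (hr0 n)] using hr1 n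
  set u : ℕ → ℝ → ℝ := fun n t => (F (r n * cayley t)).re with hu
  have hucont : ∀ n, Continuous (u n) := fun n =>
    Complex.continuous_re.comp (hF.continuousOn.comp_continuous
      (continuous_const.mul continuous_cayley) fun t => by simpa using hin n t)
  have hubd : ∀ n t, u n t ∈ Set.Icc lo hi := fun n t => hb _ (hin n t)
  obtain ⟨v, l, hl, hle, hvm, hvb, hlim⟩ := exists_tendsto_integral_mul (cauchyMeasure 0 1) u
    (fun n => (hucont n).measurable) hubd
  have hvnorm : ∀ᵐ t ∂(cauchyMeasure 0 1), ‖v t‖ ≤ max |lo| |hi| := by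
    filter_upwards [hvb] with t ht
    exact abs_le_max_abs_abs ht.1 ht.2
  refine ⟨v, hvm, hvb, fun w hw => ?_⟩
  have hKc := continuous_schwarzKernel hw
  have hK := norm_schwarzKernel_le hw
  have hKint : Integrable (schwarzKernel w) (cauchyMeasure 0 1) :=
    Integrable.of_bound hKc.aestronglyMeasurable _ (Eventually.of_forall hK)
  have hintv : ∀ f : ℝ → ℝ, Measurable f →
      (∀ᵐ t ∂(cauchyMeasure 0 1), ‖f t‖ ≤ max |lo| |hi|) →
      Integrable (fun t => schwarzKernel w t * (f t : ℂ)) (cauchyMeasure 0 1) := fun f hf hfb =>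
    hKint.mul_bdd (c := max |lo| |hi|)
      (Complex.measurable_ofReal.comp hf).aestronglyMeasurable
      (by filter_upwards [hfb] with t ht; simpa using ht)
  have hun : ∀ n, ∀ᵐ t ∂(cauchyMeasure 0 1), ‖u n t‖ ≤ max |lo| |hi| := fun n =>
    Eventually.of_forall fun t => abs_le_max_abs_abs (hubd n t).1 (hubd n t).2
  refine ⟨hintv v hvm hvnorm, ?_⟩
  have hmre : MemLp (fun t => (schwarzKernel w t).re) 2 (cauchyMeasure 0 1) :=
    MemLp.of_bound (Complex.continuous_re.comp hKc).aestronglyMeasurable (2 / (1 - ‖w‖))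
      (Eventually.of_forall fun t => (Complex.abs_re_le_norm _).trans (hK t))
  have hmim : MemLp (fun t => (schwarzKernel w t).im) 2 (cauchyMeasure 0 1) :=
    MemLp.of_bound (Complex.continuous_im.comp hKc).aestronglyMeasurable (2 / (1 - ‖w‖))
      (Eventually.of_forall fun t => (Complex.abs_im_le_norm _).trans (hK t))
  -- The weak limit is tested on real functions, so the kernel is split into its bounded real and
  -- imaginary parts.
  have hsplit : ∀ f : ℝ → ℝ, Integrable (fun t => schwarzKernel w t * (f t : ℂ))
      (cauchyMeasure 0 1) → ∫ t, schwarzKernel w t * (f t : ℂ) ∂(cauchyMeasure 0 1) =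
      ((∫ t, f t * (schwarzKernel w t).re ∂(cauchyMeasure 0 1) : ℝ) : ℂ) +
      ((∫ t, f t * (schwarzKernel w t).im ∂(cauchyMeasure 0 1) : ℝ) : ℂ) * Complex.I := by
    intro f hf
    rw [← integral_re_add_im hf]
    simp [mul_comm]
  have h1 : Tendsto (fun n => ∫ t, schwarzKernel w t * (u n t : ℂ) ∂(cauchyMeasure 0 1)) l
      (𝓝 (∫ t, schwarzKernel w t * (v t : ℂ) ∂(cauchyMeasure 0 1))) := by
    rw [hsplit v (hintv v hvm hvnorm)]
    simp only [fun n => hsplit (u n) (hintv (u n) (hucont n).measurable (hun n))]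
    exact ((Complex.continuous_ofReal.tendsto _).comp (hlim _ hmre)).add
      (((Complex.continuous_ofReal.tendsto _).comp (hlim _ hmim)).mul_const _)
  have h2 : Tendsto (fun n => F (r n * w)) l (𝓝 (F w)) := by
    have hFc : ContinuousAt F w := (hF.differentiableAt
      (Metric.isOpen_ball.mem_nhds (by simpa using hw))).continuousAt
    have h3 : Tendsto (fun n => (r n : ℂ) * w) l (𝓝 w) := by
      have := (((Complex.continuous_ofReal.tendsto 1).comp hrlim).mul_const w).mono_left hle
      simpa using this
    exact hFc.tendsto.comp h3
  refine tendsto_nhds_unique h2 (h1.congr fun n => ?_)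
  exact integral_schwarzKernel_mul_re hF hF0 (hr0 n) (hr1 n) hw

/-- Both sides equal `(1 + t z)/((t - z)(1 + t²))`. -/
lemma schwarzKernel_cayley {z : ℂ} (hz : 0 < z.im) (t : ℝ) :
    1 / ((t : ℂ) - z) - (t : ℂ) / (1 + (t : ℂ) ^ 2) = Complex.I * (1 + (t : ℂ) ^ 2)⁻¹ *
      schwarzKernel ((z - Complex.I) / (z + Complex.I)) t := by
  obtain ⟨hw, hz0⟩ := norm_sub_div_add_lt_one hz
  have h1 := ofReal_add_I_ne_zero t
  have h2 := one_add_ofReal_sq_ne_zero t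
  have h3 : (t : ℂ) - z ≠ 0 := fun h => by
    have := congrArg Complex.im h
    simp at this
    linarith
  have h4 : cayley t - (z - Complex.I) / (z + Complex.I) =
      2 * Complex.I * (t - z) / ((t + Complex.I) * (z + Complex.I)) := by
    rw [cayley]; field_simp; ring
  have h5 : cayley t + (z - Complex.I) / (z + Complex.I) =
      2 * (1 + t * z) / ((t + Complex.I) * (z + Complex.I)) := by
    rw [cayley]; field_simp
    linear_combination -2 * Complex.I_sq
  rw [schwarzKernel, h4, h5]
  field_simp
  ring

end WeylTitchmarsh

/-! ### Return to the upper half-plane -/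

namespace WeylTitchmarsh

open Filter Topology MeasureTheory ProbabilityTheory ComplexConjugate

lemma differentiableOn_inner_inverse {H : Type*} [NormedAddCommGroup H] [InnerProductSpace ℂ H]
    [CompleteSpace H] {V : H →L[ℂ] H} (hV : ‖V‖ ≤ 1) (g : H) :
    DifferentiableOn ℂ (fun w : ℂ => 2 * inner ℂ g (Ring.inverse (1 - w • V) g) - 1)
      (Metric.ball 0 1) := by
  intro w hw
  have hu := IsCayleyTransform.isUnit_one_sub_smul hV (w := w) (by simpa using hw)
  have h1 : DifferentiableAt ℂ (fun w : ℂ => Ring.inverse (1 - w • V)) w :=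
    DifferentiableAt.comp (g := Ring.inverse) w (differentiableAt_inverse hu) (by fun_prop)
  have h2 : DifferentiableAt ℂ (fun w : ℂ => innerSL ℂ g (Ring.inverse (1 - w • V) g)) w :=
    (innerSL ℂ g).differentiableAt.comp w (h1.clm_apply (differentiableAt_const g))
  exact ((h2.const_mul 2).sub_const 1).differentiableWithinAt

/-- The endpoints are center minus radius and center plus radius. -/
lemma re_mem_Icc_of_mem_disk {ρ : ℝ} (hρ0 : 0 ≤ ρ) (hρ : ρ < 1) {w : ℂ} (hw : ‖w‖ < 1) :
    ((((1 + ρ ^ 2) / (1 - ρ ^ 2) : ℝ) : ℂ) + ((2 * ρ / (1 - ρ ^ 2) : ℝ) : ℂ) * w).re ∈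
      Set.Icc ((1 - ρ) / (1 + ρ)) ((1 + ρ) / (1 - ρ)) := by
  have h1 : 0 < 1 - ρ := by linarith
  have h2 : 0 < 1 + ρ := by linarith
  have h3 : 1 - ρ ^ 2 = (1 - ρ) * (1 + ρ) := by ring
  have hre := abs_le.1 ((Complex.abs_re_le_norm w).trans hw.le)
  rw [Complex.add_re, Complex.ofReal_re, Complex.re_ofReal_mul, h3]
  have hr : 0 ≤ 2 * ρ / ((1 - ρ) * (1 + ρ)) := by positivity
  have e1 : (1 - ρ) / (1 + ρ) = (1 + ρ ^ 2) / ((1 - ρ) * (1 + ρ)) +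
      2 * ρ / ((1 - ρ) * (1 + ρ)) * (-1) := by
    field_simp; ring
  have e2 : (1 + ρ) / (1 - ρ) = (1 + ρ ^ 2) / ((1 - ρ) * (1 + ρ)) +
      2 * ρ / ((1 - ρ) * (1 + ρ)) * 1 := by
    field_simp; ring
  rw [e1, e2]
  constructor <;> gcongr
  exacts [hre.1, hre.2]

end WeylTitchmarsh

open WeylTitchmarsh in
theorem corollary3p3 {H : Type*} [NormedAddCommGroup H] [InnerProductSpace ℂ H] [CompleteSpace H]
    (Adot Ahat A : H →ₗ.[ℂ] H) (gp gm : H) (κ : ℂ)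
    (hAdot : IsSymmetricOp Adot) (hdef : HasDeficiencyIndicesOneOne Adot)
    (hAhat : IsMaximalDissipative Ahat) (hAhat_ext : Adot ≤ Ahat) (hAhat_ne : Ahat ≠ Ahat†)
    (hA : IsSelfAdjoint A) (hA_ext : Adot ≤ A)
    (hgp : gp ∈ deficiencySpace Adot Complex.I) (hgp_norm : ‖gp‖ = 1)
    (hgm : gm ∈ deficiencySpace Adot (-Complex.I)) (hgm_norm : ‖gm‖ = 1)
    (hA_dom : gp - gm ∈ A.domain)
    (hκ : ‖κ‖ < 1) (hAhat_dom : gp - κ • gm ∈ Ahat.domain) :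
    -- the Weyl-Titchmarsh function is well defined and analytic in the upper half-plane
    {z : ℂ | 0 < z.im} ⊆ WeylTitchmarsh.resolventSet Ahat† ∧
    AnalyticOnNhd ℂ (weylFunction Ahat gp) {z : ℂ | 0 < z.im} ∧
    -- its values lie in the disk `c + r 𝔻`, with `𝔻` the open unit disk
    (∀ z : ℂ, 0 < z.im → ∃ w : ℂ, ‖w‖ < 1 ∧
      weylFunction Ahat gp z =
        Complex.I * (((1 + ‖κ‖ ^ 2) / (1 - ‖κ‖ ^ 2) : ℝ) : ℂ) +
          ((2 * ‖κ‖ / (1 - ‖κ‖ ^ 2) : ℝ) : ℂ) * w) ∧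
    -- Herglotz-Nevanlinna representation with an absolutely continuous measure
    ∃ f : ℝ → ℝ, Measurable f ∧
      (∀ z : ℂ, 0 < z.im →
        MeasureTheory.Integrable (fun t : ℝ =>
          (1 / ((t : ℂ) - z) - (t : ℂ) / (1 + (t : ℂ) ^ 2)) * (f t : ℂ)) ∧
        weylFunction Ahat gp z =
          ∫ t : ℝ, (1 / ((t : ℂ) - z) - (t : ℂ) / (1 + (t : ℂ) ^ 2)) * (f t : ℂ)) ∧
      (∀ᵐ t : ℝ, 1 / Real.pi * ((1 - ‖κ‖) / (1 + ‖κ‖)) ≤ f t ∧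
        f t ≤ 1 / Real.pi * ((1 + ‖κ‖) / (1 - ‖κ‖))) ∧
      MeasureTheory.Integrable (fun t : ℝ => f t / (1 + t ^ 2)) ∧
      ∫ t : ℝ, f t / (1 + t ^ 2) = 1 := by
  obtain ⟨V, hV, hVi, hVn⟩ := exists_isCayleyTransform hAdot hdef hAhat.1 hAhat_ext hgp hgp_norm
    hgm hgm_norm hκ hAhat_dom
  set F : ℂ → ℂ := fun w => 2 * inner ℂ gp (Ring.inverse (1 - w • V) gp) - 1 with hFdef
  have hF : DifferentiableOn ℂ F (Metric.ball 0 1) := differentiableOn_inner_inverse hV.norm_le gp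
  have hF0 : F 0 = 1 := by
    simp [hFdef, inner_self_eq_norm_sq_to_K, hgp_norm]
    norm_num
  have hM : ∀ z : ℂ, 0 < z.im →
      weylFunction Ahat gp z = Complex.I * F ((z - Complex.I) / (z + Complex.I)) := fun z hz =>
    hV.inner_resolvent_eq hz hgp_norm
  have hdisk : ∀ w : ℂ, ‖w‖ < 1 → ∃ q : ℂ, ‖q‖ < 1 ∧
      F w = (((1 + ‖κ‖ ^ 2) / (1 - ‖κ‖ ^ 2) : ℝ) : ℂ) +
        ((2 * ‖κ‖ / (1 - ‖κ‖ ^ 2) : ℝ) : ℂ) * q := by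
    intro w hw
    obtain ⟨s, hs, hs'⟩ := inner_inverse_eq hV.norm_le hgp_norm hVi hVn hw
    obtain ⟨q, hq, hq'⟩ := mobius_mem_disk hκ hs
    exact ⟨q, hq, by rw [← hq', hFdef, ← hs']⟩
  refine ⟨fun z hz => hV.mem_resolventSet hz, ?_, ?_, ?_⟩
  · have hopen : IsOpen {z : ℂ | 0 < z.im} := isOpen_lt continuous_const Complex.continuous_im
    refine DifferentiableOn.analyticOnNhd ?_ hopen
    refine DifferentiableOn.congr (f := fun z =>
      Complex.I * F ((z - Complex.I) / (z + Complex.I))) ?_ hM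
    refine (hF.comp ?_ fun z hz => ?_).const_mul _
    · intro z hz
      have hz0 : z + Complex.I ≠ 0 := (norm_sub_div_add_lt_one hz).2
      fun_prop (disch := assumption)
    · simpa using (norm_sub_div_add_lt_one hz).1
  · intro z hz
    obtain ⟨q, hq, hq'⟩ := hdisk _ (norm_sub_div_add_lt_one hz).1
    refine ⟨Complex.I * q, by simpa using hq, ?_⟩
    rw [hM z hz, hq']
    ring
  · obtain ⟨v, hvm, hvb, hv⟩ := exists_eq_integral_schwarzKernel hF (by simp [hF0])
      (lo := (1 - ‖κ‖) / (1 + ‖κ‖)) (hi := (1 + ‖κ‖) / (1 - ‖κ‖)) fun w hw => by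
        obtain ⟨q, hq, hq'⟩ := hdisk w hw
        rw [hq']
        exact re_mem_Icc_of_mem_disk (norm_nonneg κ) hκ hq
    have hpi : (Real.pi : ℂ) ≠ 0 := by exact_mod_cast Real.pi_ne_zero
    have hker : ∀ z : ℂ, 0 < z.im → ∀ t : ℝ,
        (1 / ((t : ℂ) - z) - (t : ℂ) / (1 + (t : ℂ) ^ 2)) * ((1 / Real.pi * v t : ℝ) : ℂ) =
        (Real.pi⁻¹ * (1 + t ^ 2)⁻¹ : ℝ) • (Complex.I *
          (schwarzKernel ((z - Complex.I) / (z + Complex.I)) t * (v t : ℂ))) := fun z hz t => by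
      rw [schwarzKernel_cayley hz, Complex.real_smul]
      push_cast
      ring
    have hreal : ∀ t : ℝ, 1 / Real.pi * v t / (1 + t ^ 2) =
        (Real.pi⁻¹ * (1 + t ^ 2)⁻¹) • v t := fun t => by
      rw [smul_eq_mul, div_eq_mul_inv, one_div]
      ring
    -- The point `w = 0` corresponds to `z = i`; there the representation says that `v` has Cauchy
    -- mean `F 0 = 1`, which is the normalization of `f`.
    have hzero : ∀ t : ℝ, schwarzKernel 0 t = 1 := fun t => by
      simp [schwarzKernel, cayley_ne_zero]
    obtain ⟨hint0, hval0⟩ := hv 0 (by simp)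
    simp only [hzero, one_mul] at hint0 hval0
    -- The factor `1/π` comes from the Cauchy density `1/(π(1 + t²))`.
    refine ⟨fun t => 1 / Real.pi * v t, hvm.const_mul _, fun z hz => ?_, ?_, ?_, ?_⟩
    · obtain ⟨hint, hval⟩ := hv _ (norm_sub_div_add_lt_one hz).1
      simp only [hker z hz]
      rw [← integrable_cauchyMeasure_iff, ← integral_cauchyMeasure, MeasureTheory.integral_const_mul,
        ← hval]
      exact ⟨hint.const_mul _, hM z hz⟩
    · filter_upwards [ae_of_ae_cauchyMeasure hvb] with t ht
      have : 0 ≤ 1 / Real.pi := by positivity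
      exact ⟨mul_le_mul_of_nonneg_left ht.1 this, mul_le_mul_of_nonneg_left ht.2 this⟩
    · simp only [hreal]
      rw [← integrable_cauchyMeasure_iff]
      simpa using hint0.re
    · simp only [hreal]
      rw [← integral_cauchyMeasure]
      rw [hF0, integral_complex_ofReal] at hval0
      exact_mod_cast hval0.symm
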